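/- Let $d\in\mathbb N$, $\lambda,\delta>0$, and let $f:\mathbb R^d\to\mathbb R$ be continuous with at least one minimizer and $\int_{\mathbb R^d} e^{-f(y)/\delta}\,dy<\infty$. Define $$\operatorname{zprox}^{\delta}_{\lambda,f}(x)=\frac{\mathbb E_{y\sim\mathcal N(x,\lambda\delta I)}\left[y\,e^{-f(y)/\delta}\right]}{\mathbb E_{y\sim\mathcal N(x,\lambda\delta I)}\left[e^{-f(y)/\delta}\right]},\qquad f^{\lambda,\delta}(x)=-\delta\log \mathbb E_{y\sim\mathcal N(x,\lambda\delta I)}\left[e^{-f(y)/\delta}\right],$$ assume that $f^{\lambda,\delta}$ is convex, and put $X^\star_{\lambda,\delta}=\operatorname{argmin} f^{\lambda,\delta}$. Let $(N_k)_{k\in\mathbb N}$ be positive integers with $\sum_{k} N_k^{-1/2}<\infty$, let $x^0\in\mathbb R^d$, and let $(x^k)_{k\in\mathbb N}$ be generated by S-ZOPPA: for every $k\ge 0$, conditionally on all samples drawn at the steps before $k$, the points $y^k_1,\dots,y^k_{N_k}$ are i.i.d. with law $\mathcal N(x^k,\lambda\delta I)$, and $$x^{k+1}=\frac{\sum_{i=1}^{N_k}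 y^k_i\,e^{-f(y^k_i)/\delta}}{\sum_{i=1}^{N_k} e^{-f(y^k_i)/\delta}}.$$ Let $E$ be the event that $(x^k)_{k\in\mathbb N}$ is bounded and that there exists $\varepsilon>0$ such that $\frac1{N_k}\sum_{i=1}^{N_k}e^{-f(y^k_i)/\delta}\ge\varepsilon$ for every $k\in\mathbb N$. Then, almost surely on $E$, $$\sum_{k\in\mathbb N}\left\|\operatorname{zprox}^{\delta}_{\lambda,f}(x^k)-x^k\right\|^2<\infty .$$ Furthermore, there exists a random variable $\bar x$ taking values in $X^\star_{\lambda,\delta}$ such that $x^k\to\bar x$ almost surely on $E$. In particular, if $E$ has probability one, both conclusions hold with probability one. -/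

import Mathlib

open MeasureTheory ProbabilityTheory Filter Topology

noncomputable section

namespace SZoppa

/-- The standing assumption on the objective `f` at temperature `δ`: `f` is continuous, has at least
one minimizer, and `exp (-f / δ)` is Lebesgue integrable. -/
structure StandingAssumption {d : ℕ} (f : EuclideanSpace ℝ (Fin d) → ℝ) (δ : ℝ) : Prop where
  continuous : Continuous f
  exists_minimizer : ∃ z, ∀ y, f z ≤ f y
  integrable : Integrable (fun y => Real.exp (-f y / δ)) (volume : Measure (EuclideanSpace ℝ (Fin d)))

/-- The isotropic Gaussian law `N(x, λδ I)` on `ℝ^d`. -/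
def gaussian {d : ℕ} (lam δ : ℝ) (x : EuclideanSpace ℝ (Fin d)) :
    Measure (EuclideanSpace ℝ (Fin d)) :=
  multivariateGaussian x ((lam * δ) • (1 : Matrix (Fin d) (Fin d) ℝ))

/-- The zeroth-order proximal operator
`zprox(x) = E[y exp(-f(y)/δ)] / E[exp(-f(y)/δ)]`, with `y ∼ N(x, λδ I)`. -/
def zprox {d : ℕ} (f : EuclideanSpace ℝ (Fin d) → ℝ) (lam δ : ℝ)
    (x : EuclideanSpace ℝ (Fin d)) : EuclideanSpace ℝ (Fin d) :=
  (∫ y, Real.exp (-f y / δ) ∂(gaussian lam δ x))⁻¹ •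
    ∫ y, Real.exp (-f y / δ) • y ∂(gaussian lam δ x)

/-- The soft Moreau envelope `f^{λ,δ}(x) = -δ log E[exp(-f(y)/δ)]`, with `y ∼ N(x, λδ I)`. -/
def softMoreau {d : ℕ} (f : EuclideanSpace ℝ (Fin d) → ℝ) (lam δ : ℝ)
    (x : EuclideanSpace ℝ (Fin d)) : ℝ :=
  -δ * Real.log (∫ y, Real.exp (-f y / δ) ∂(gaussian lam δ x))

/-- The set of global minimizers of `g`. -/
def argmin {d : ℕ} (g : EuclideanSpace ℝ (Fin d) → ℝ) : Set (EuclideanSpace ℝ (Fin d)) :=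
  {z | ∀ y, g z ≤ g y}

/-- The empirical normalization `(1/n) ∑ᵢ exp(-f(yᵢ)/δ)` of a sample `y₁, …, yₙ`. -/
def empiricalNormalization {d n : ℕ} (f : EuclideanSpace ℝ (Fin d) → ℝ) (δ : ℝ)
    (y : Fin n → EuclideanSpace ℝ (Fin d)) : ℝ :=
  (1 / (n : ℝ)) * ∑ i, Real.exp (-f (y i) / δ)

/-- The Monte Carlo estimator `∑ᵢ yᵢ exp(-f(yᵢ)/δ) / ∑ᵢ exp(-f(yᵢ)/δ)` of the zeroth-order proximal
operator, computed from a sample `y₁, …, yₙ`. -/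
def zproxHat {d n : ℕ} (f : EuclideanSpace ℝ (Fin d) → ℝ) (δ : ℝ)
    (y : Fin n → EuclideanSpace ℝ (Fin d)) : EuclideanSpace ℝ (Fin d) :=
  (∑ i, Real.exp (-f (y i) / δ))⁻¹ • ∑ i, Real.exp (-f (y i) / δ) • y i

/-- The σ-algebra generated by all samples drawn before step `k`. -/
@[reducible] def history {Ω : Type*} {d : ℕ} {N : ℕ → ℕ}
    (y : (k : ℕ) → Fin (N k) → Ω → EuclideanSpace ℝ (Fin d)) (k : ℕ) : MeasurableSpace Ω :=
  ⨆ (j : ℕ) (_ : j < k) (i : Fin (N j)), MeasurableSpace.comap (y j i) inferInstance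

/-- `x` is a sequence of S-ZOPPA iterates started at the deterministic point `x₀`, with sample sizes
`N k` and samples `y k i`, `i < N k`: conditionally on everything sampled before step `k`, the
samples of step `k` are i.i.d. with law `N(x^k, λδ I)`, and `x^{k+1}` is the Monte Carlo estimator
computed from them. -/
structure IsSZoppa {Ω : Type*} [MeasurableSpace Ω] (P : Measure Ω) {d : ℕ}
    (f : EuclideanSpace ℝ (Fin d) → ℝ) (lam δ : ℝ) (N : ℕ → ℕ)
    (x₀ : EuclideanSpace ℝ (Fin d))
    (y : (k : ℕ) → Fin (N k) → Ω → EuclideanSpace ℝ (Fin d))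
    (x : ℕ → Ω → EuclideanSpace ℝ (Fin d)) : Prop where
  measurable_sample : ∀ k i, Measurable (y k i)
  initial : ∀ ω, x 0 ω = x₀
  step : ∀ k ω, x (k + 1) ω = zproxHat f δ (fun i => y k i ω)
  sampling : ∀ (k : ℕ) (B : Fin (N k) → Set (EuclideanSpace ℝ (Fin d))),
    (∀ i, MeasurableSet (B i)) →
      P⟦⋂ i, y k i ⁻¹' B i | history y k⟧
        =ᵐ[P] fun ω => ∏ i, (gaussian lam δ (x k ω)).real (B i)

end SZoppa

end

noncomputable section

namespace SZoppa

open scoped RealInnerProductSpace ENNReal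

/-! Put `F = λ f^{λ,δ}` and `G x = x - zprox x`. The Gaussian density ratio between two centres is
log-affine in `y`, so the tangent bound `1 + u ≤ exp u` gives the descent inequality for the pair
`F`, `G` (`descentInequality`). With convexity this makes `G` cocoercive (`sq_norm_sub_le_inner`),
without differentiating under an integral. A minimizer of `F` exists because integrability of `exp
(-f/δ)` makes the envelope coercive.

S-ZOPPA is thus the step `x - G x` with an added error. Bounded iterates and summable errors make
the squared distance to every minimizer quasi-Fejér monotone, giving square summability and
convergence (`DescentInequality.summable_and_tendsto`).

The error is a centred sample mean divided by the empirical normalization, which is at least `ε` on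
the event. On `‖x k‖ ≤ M` the mean has expected norm `O((N k)^(-1/2))`, so the series of these norms
has finite expectation and converges almost surely; countably many `M` suffice. -/

/-- The Lebesgue density of the Gaussian law `N(x, s I)`. -/
def isotropicDensity {d : ℕ} (s : ℝ) (x y : EuclideanSpace ℝ (Fin d)) : ℝ :=
  (∫ v : EuclideanSpace ℝ (Fin d), Real.exp (-(2 * s)⁻¹ * ‖v‖ ^ 2))⁻¹ *
    Real.exp (-(2 * s)⁻¹ * ‖y - x‖ ^ 2)

/-! ### The isotropic Gaussian density and its characteristic function. -/

section Density

variable {d : ℕ} {s : ℝ}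

lemma integrable_exp_neg_mul_sq_norm (hs : 0 < s) :
    Integrable (fun v : EuclideanSpace ℝ (Fin d) => Real.exp (-(2 * s)⁻¹ * ‖v‖ ^ 2)) := by
  have hb : 0 < (((2 * s)⁻¹ : ℝ) : ℂ).re := by rw [Complex.ofReal_re]; positivity
  have h := (GaussianFourier.integrable_cexp_neg_mul_sq_norm_add hb 0
    (0 : EuclideanSpace ℝ (Fin d))).norm
  refine h.congr (ae_of_all _ fun v => ?_)
  have : (-(((2 * s)⁻¹ : ℝ) : ℂ) * (‖v‖ : ℂ) ^ 2
      + 0 * ((⟪(0 : EuclideanSpace ℝ (Fin d)), v⟫ : ℝ) : ℂ))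
      = ((-(2 * s)⁻¹ * ‖v‖ ^ 2 : ℝ) : ℂ) := by push_cast; simp
  simp only [this, Complex.norm_exp_ofReal]

lemma integral_exp_neg_mul_sq_norm_pos (hs : 0 < s) :
    0 < ∫ v : EuclideanSpace ℝ (Fin d), Real.exp (-(2 * s)⁻¹ * ‖v‖ ^ 2) :=
  integral_exp_pos (integrable_exp_neg_mul_sq_norm hs)

lemma isotropicDensity_pos (hs : 0 < s) (x y : EuclideanSpace ℝ (Fin d)) :
    0 < isotropicDensity s x y :=
  mul_pos (inv_pos.2 (integral_exp_neg_mul_sq_norm_pos hs)) (Real.exp_pos _)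

lemma isotropicDensity_le (hs : 0 < s) (x y : EuclideanSpace ℝ (Fin d)) :
    isotropicDensity s x y ≤
      (∫ v : EuclideanSpace ℝ (Fin d), Real.exp (-(2 * s)⁻¹ * ‖v‖ ^ 2))⁻¹ := by
  refine mul_le_of_le_one_right (inv_pos.2 (integral_exp_neg_mul_sq_norm_pos hs)).le ?_
  rw [Real.exp_le_one_iff, neg_mul, neg_nonpos]
  positivity

lemma continuous_isotropicDensity (x : EuclideanSpace ℝ (Fin d)) :
    Continuous (isotropicDensity s x) := by
  unfold isotropicDensity
  fun_prop

lemma integrable_isotropicDensity (hs : 0 < s) (x : EuclideanSpace ℝ (Fin d)) :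
    Integrable (isotropicDensity s x) :=
  ((integrable_exp_neg_mul_sq_norm hs).comp_sub_right x).const_mul _

/-- The terms quadratic in `y` cancel between the two centres, leaving an exponential tilt. -/
lemma isotropicDensity_eq_mul_exp (x x' y : EuclideanSpace ℝ (Fin d)) :
    isotropicDensity s x' y = isotropicDensity s x y *
      Real.exp (s⁻¹ * ⟪x' - x, y⟫ - (2 * s)⁻¹ * (‖x'‖ ^ 2 - ‖x‖ ^ 2)) := by
  unfold isotropicDensity
  rw [mul_assoc, ← Real.exp_add]
  congr 2
  rw [norm_sub_sq_real, norm_sub_sq_real, inner_sub_left, real_inner_comm x y,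
    real_inner_comm x' y, mul_inv]
  ring

lemma charFun_withDensity_isotropicDensity (hs : 0 < s) (x t : EuclideanSpace ℝ (Fin d)) :
    charFun (volume.withDensity fun y => ENNReal.ofReal (isotropicDensity s x y)) t =
      Complex.exp (⟪x, t⟫ * Complex.I - s * ‖t‖ ^ 2 / 2) := by
  have hb : 0 < (((2 * s)⁻¹ : ℝ) : ℂ).re := by rw [Complex.ofReal_re]; positivity
  have hsC : (s : ℂ) ≠ 0 := by exact_mod_cast hs.ne'
  set c : ℝ := ∫ v : EuclideanSpace ℝ (Fin d), Real.exp (-(2 * s)⁻¹ * ‖v‖ ^ 2) with hc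
  have hcC : (c : ℂ) ≠ 0 := by exact_mod_cast (integral_exp_neg_mul_sq_norm_pos hs).ne'
  -- The normalizer `c` is the very power that the Fourier integral produces, so it cancels without
  -- being evaluated.
  have hnorm : (c : ℂ) = (Real.pi / (((2 * s)⁻¹ : ℝ) : ℂ)) ^
      (Module.finrank ℝ (EuclideanSpace ℝ (Fin d)) / 2 : ℂ) := by
    rw [← GaussianFourier.integral_cexp_neg_mul_sq_norm hb, hc, ← integral_complex_ofReal]
    congr 1 with v
    push_cast
    rfl
  rw [charFun_apply, integral_withDensity_eq_integral_toReal_smul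
    (continuous_isotropicDensity x).measurable.ennreal_ofReal
    (ae_of_all _ fun _ => ENNReal.ofReal_lt_top)]
  rw [← integral_add_right_eq_self _ x]
  have key : ∀ v : EuclideanSpace ℝ (Fin d),
      (ENNReal.ofReal (isotropicDensity s x (v + x))).toReal •
        Complex.exp (⟪v + x, t⟫ * Complex.I) =
      ((c : ℂ)⁻¹ * Complex.exp (⟪x, t⟫ * Complex.I)) *
        Complex.exp (-(((2 * s)⁻¹ : ℝ) : ℂ) * (‖v‖ : ℂ) ^ 2 + Complex.I * (⟪t, v⟫ : ℝ)) := by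
    intro v
    rw [ENNReal.toReal_ofReal (isotropicDensity_pos hs _ _).le, isotropicDensity, ← hc,
      add_sub_cancel_right, Complex.real_smul, inner_add_left, real_inner_comm]
    push_cast
    rw [mul_assoc, mul_assoc, ← Complex.exp_add, ← Complex.exp_add]
    congr 2
    ring
  simp_rw [key]
  rw [integral_const_mul, GaussianFourier.integral_cexp_neg_mul_sq_norm_add hb, ← hnorm]
  rw [mul_assoc, mul_left_comm (Complex.exp _), ← mul_assoc, inv_mul_cancel₀ hcC, one_mul,
    ← Complex.exp_add]
  congr 1
  push_cast
  rw [Complex.I_sq]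
  field_simp
  ring

lemma isFiniteMeasure_withDensity_isotropicDensity (hs : 0 < s) (x : EuclideanSpace ℝ (Fin d)) :
    IsFiniteMeasure (volume.withDensity fun y => ENNReal.ofReal (isotropicDensity s x y)) :=
  isFiniteMeasure_withDensity_ofReal (integrable_isotropicDensity hs x).2

end Density

/-! ### Density and translation forms of the Gaussian law. -/

section Gaussian

variable {d : ℕ} {lam δ : ℝ}

instance (x : EuclideanSpace ℝ (Fin d)) : IsProbabilityMeasure (gaussian lam δ x) := by
  unfold gaussian; infer_instance

instance (x : EuclideanSpace ℝ (Fin d)) : IsGaussian (gaussian lam δ x) := by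
  unfold gaussian; infer_instance

lemma gaussian_eq_withDensity (hlam : 0 < lam) (hδ : 0 < δ) (x : EuclideanSpace ℝ (Fin d)) :
    gaussian lam δ x =
      volume.withDensity fun y => ENNReal.ofReal (isotropicDensity (lam * δ) x y) := by
  have hs : 0 < lam * δ := mul_pos hlam hδ
  have := isFiniteMeasure_withDensity_isotropicDensity hs x
  apply Measure.ext_of_charFun
  ext t
  rw [charFun_withDensity_isotropicDensity hs, gaussian,
    charFun_multivariateGaussian (Matrix.PosSemidef.one.smul hs.le), real_inner_comm]
  congr 2
  rw [Matrix.smul_mulVec, Matrix.one_mulVec, dotProduct_smul, EuclideanSpace.norm_eq,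
    ← Complex.ofReal_pow, Real.sq_sqrt (Finset.sum_nonneg fun _ _ => by positivity)]
  simp [dotProduct, sq]

/-- Gives a reference law independent of the centre, for uniform moment bounds and for measurability
in the centre. -/
lemma gaussian_eq_map_add (x : EuclideanSpace ℝ (Fin d)) :
    gaussian lam δ x = (gaussian lam δ 0).map (fun v => x + v) := by
  unfold gaussian multivariateGaussian
  rw [Measure.map_map (by fun_prop) (by fun_prop)]
  congr 1
  ext1 v
  simp

variable {E : Type*} [NormedAddCommGroup E] [NormedSpace ℝ E]

lemma integral_gaussian (hlam : 0 < lam) (hδ : 0 < δ) (x : EuclideanSpace ℝ (Fin d))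
    (g : EuclideanSpace ℝ (Fin d) → E) :
    ∫ y, g y ∂(gaussian lam δ x) = ∫ y, isotropicDensity (lam * δ) x y • g y := by
  have hs : 0 < lam * δ := mul_pos hlam hδ
  rw [gaussian_eq_withDensity hlam hδ, integral_withDensity_eq_integral_toReal_smul
    (continuous_isotropicDensity x).measurable.ennreal_ofReal
    (ae_of_all _ fun _ => ENNReal.ofReal_lt_top)]
  simp_rw [ENNReal.toReal_ofReal (isotropicDensity_pos hs _ _).le]

lemma integral_gaussian_shift (hlam : 0 < lam) (hδ : 0 < δ) (x x' : EuclideanSpace ℝ (Fin d))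
    (g : EuclideanSpace ℝ (Fin d) → ℝ) :
    ∫ y, g y ∂(gaussian lam δ x') = ∫ y, Real.exp ((lam * δ)⁻¹ * ⟪x' - x, y⟫ -
      (2 * (lam * δ))⁻¹ * (‖x'‖ ^ 2 - ‖x‖ ^ 2)) * g y ∂(gaussian lam δ x) := by
  rw [integral_gaussian hlam hδ, integral_gaussian hlam hδ]
  congr 1 with y
  rw [isotropicDensity_eq_mul_exp x x', smul_eq_mul, smul_eq_mul, mul_assoc]

lemma integrable_gaussian_shift (hlam : 0 < lam) (hδ : 0 < δ) (x x' : EuclideanSpace ℝ (Fin d))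
    {g : EuclideanSpace ℝ (Fin d) → ℝ} (hg : Integrable g (gaussian lam δ x')) :
    Integrable (fun y => Real.exp ((lam * δ)⁻¹ * ⟪x' - x, y⟫ -
      (2 * (lam * δ))⁻¹ * (‖x'‖ ^ 2 - ‖x‖ ^ 2)) * g y) (gaussian lam δ x) := by
  have hs : 0 < lam * δ := mul_pos hlam hδ
  have hm : ∀ x : EuclideanSpace ℝ (Fin d),
      Measurable fun y => ENNReal.ofReal (isotropicDensity (lam * δ) x y) :=
    fun x => (continuous_isotropicDensity x).measurable.ennreal_ofReal
  rw [gaussian_eq_withDensity hlam hδ, integrable_withDensity_iff_integrable_smul' (hm _)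
    (ae_of_all _ fun _ => ENNReal.ofReal_lt_top)] at hg ⊢
  refine hg.congr (ae_of_all _ fun y => ?_)
  simp only [ENNReal.toReal_ofReal (isotropicDensity_pos hs _ _).le, smul_eq_mul]
  rw [isotropicDensity_eq_mul_exp x x', mul_assoc]

end Gaussian

/-! ### Cocoercivity from convexity and the descent inequality. -/

section GradientStep

variable {E : Type*} [NormedAddCommGroup E] [InnerProductSpace ℝ E] {F : E → ℝ} {G : E → E}

/-- `F` satisfies the descent inequality: `F x + ⟪x' - x, G x⟫ + ‖x' - x‖² / 2` is an upper bound
for `F x'`, as is the case when `F` has gradient `G` and `½‖·‖² - F` is convex. -/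
def DescentInequality (F : E → ℝ) (G : E → E) : Prop :=
  ∀ x x', F x' - F x ≤ ⟪x' - x, G x⟫ + ‖x' - x‖ ^ 2 / 2

namespace DescentInequality

/-- Differentiability of `F` is not needed: `x` is a convex combination of `x - t • v` and `x'`, and
the descent inequality bounds `F (x - t • v)`. Dividing by `t` and letting `t → 0` leaves the
tangent inequality. -/
lemma inner_le_sub (h : DescentInequality F G) (hF : ConvexOn ℝ Set.univ F) (x x' : E) :
    ⟪x' - x, G x⟫ ≤ F x' - F x := by
  set v := x' - x with hv
  have key : ∀ t : ℝ, 0 < t → ⟪v, G x⟫ - t * (‖v‖ ^ 2 / 2) ≤ F x' - F x := by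
    intro t ht
    have h1 := h x (x - t • v)
    have h2 : x - t • v - x = (-t) • v := by rw [neg_smul]; abel
    rw [h2, real_inner_smul_left, norm_smul, mul_pow, Real.norm_eq_abs, sq_abs] at h1
    have h3 := hF.2 (Set.mem_univ (x - t • v)) (Set.mem_univ x')
      (show 0 ≤ 1 / (1 + t) by positivity) (show 0 ≤ t / (1 + t) by positivity) (by field_simp)
    have h4 : (1 / (1 + t)) • (x - t • v) + (t / (1 + t)) • x' = x := by
      have : x' = x + v := by rw [hv]; abel
      rw [this, smul_sub, smul_add, smul_smul, add_comm ((t / (1 + t)) • x), ← add_assoc]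
      rw [show 1 / (1 + t) * t = t / (1 + t) by ring, sub_add_cancel, ← add_smul]
      rw [show 1 / (1 + t) + t / (1 + t) = 1 by field_simp, one_smul]
    rw [h4, smul_eq_mul, smul_eq_mul] at h3
    have h5 : (1 + t) * F x ≤ F (x - t • v) + t * F x' := by
      have := mul_le_mul_of_nonneg_left h3 (by positivity : 0 ≤ 1 + t)
      refine this.trans_eq ?_
      field_simp
    have h6 : t * (⟪v, G x⟫ - t * (‖v‖ ^ 2 / 2)) ≤ t * (F x' - F x) := by nlinarith
    exact le_of_mul_le_mul_left h6 ht
  have hlim : Tendsto (fun t : ℝ => ⟪v, G x⟫ - t * (‖v‖ ^ 2 / 2)) (𝓝[>] 0)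
      (𝓝 (⟪v, G x⟫ - 0 * (‖v‖ ^ 2 / 2))) :=
    (Continuous.tendsto (by fun_prop) 0).mono_left nhdsWithin_le_nhds
  rw [zero_mul, sub_zero] at hlim
  exact le_of_tendsto hlim (eventually_nhdsWithin_of_forall fun t ht => key t ht)

lemma inner_add_sq_le_sub (h : DescentInequality F G) (hF : ConvexOn ℝ Set.univ F) (x z : E) :
    ⟪z - x, G x⟫ + ‖G x - G z‖ ^ 2 / 2 ≤ F z - F x := by
  -- This shift from `z` minimizes the gap between the quadratic upper bound at `z` and the tangent
  -- at `x`.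
  set v := G x - G z with hv
  have h1 := h z (z + v)
  have h2 := h.inner_le_sub hF x (z + v)
  rw [add_sub_cancel_left] at h1
  rw [add_sub_right_comm, inner_add_left] at h2
  have h3 : ⟪v, G x⟫ - ⟪v, G z⟫ = ‖v‖ ^ 2 := by
    rw [← inner_sub_right, ← hv, real_inner_self_eq_norm_sq]
  linarith

/-- Baillon–Haddad: add the sharpened tangent inequality to itself with the points exchanged. -/
lemma sq_norm_sub_le_inner (h : DescentInequality F G) (hF : ConvexOn ℝ Set.univ F) (x z : E) :
    ‖G x - G z‖ ^ 2 ≤ ⟪x - z, G x - G z⟫ := by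
  have h1 := h.inner_add_sq_le_sub hF x z
  have h2 := h.inner_add_sq_le_sub hF z x
  rw [norm_sub_rev] at h2
  have h3 : ⟪z - x, G x⟫ = -⟪x - z, G x⟫ := by rw [← inner_neg_left, neg_sub]
  rw [inner_sub_right]
  linarith

lemma norm_map_sub_le (h : DescentInequality F G) (hF : ConvexOn ℝ Set.univ F) (x z : E) :
    ‖G x - G z‖ ≤ ‖x - z‖ := by
  have h1 := h.sq_norm_sub_le_inner hF x z
  have h2 := real_inner_le_norm (x - z) (G x - G z)
  nlinarith [norm_nonneg (G x - G z), norm_nonneg (x - z)]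

lemma lipschitzWith (h : DescentInequality F G) (hF : ConvexOn ℝ Set.univ F) :
    LipschitzWith 1 G :=
  LipschitzWith.of_dist_le_mul fun x z => by
    simpa [dist_eq_norm] using h.norm_map_sub_le hF x z

/-- A step from `z` to `z - G z` would lower `F` by at least `‖G z‖² / 2`. -/
lemma eq_zero_of_forall_le (h : DescentInequality F G) {z : E} (hz : ∀ y, F z ≤ F y) :
    G z = 0 := by
  have h1 := h z (z - G z)
  have h2 := hz (z - G z)
  rw [sub_sub_cancel_left, inner_neg_left, norm_neg, real_inner_self_eq_norm_sq] at h1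
  have : ‖G z‖ ^ 2 = 0 := le_antisymm (by linarith) (by positivity)
  exact norm_eq_zero.1 (by simpa using this)

lemma sq_norm_step_sub_le (h : DescentInequality F G) (hF : ConvexOn ℝ Set.univ F) (x : E) {z : E}
    (hz : ∀ y, F z ≤ F y) : ‖x - G x - z‖ ^ 2 ≤ ‖x - z‖ ^ 2 - ‖G x‖ ^ 2 := by
  have h1 := h.sq_norm_sub_le_inner hF x z
  rw [h.eq_zero_of_forall_le hz, sub_zero] at h1
  rw [sub_right_comm, norm_sub_sq_real]
  linarith

end DescentInequality

end GradientStep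

/-! ### Quasi-Fejér convergence of perturbed gradient steps. -/

section QuasiFejer

lemma summable_and_tendsto_of_le_sub_add {a b e : ℕ → ℝ} (ha : ∀ k, 0 ≤ a k) (hb : ∀ k, 0 ≤ b k)
    (he : Summable e) (he0 : ∀ k, 0 ≤ e k) (h : ∀ k, a (k + 1) ≤ a k - b k + e k) :
    Summable b ∧ ∃ l, Tendsto a atTop (𝓝 l) := by
  have hsum : ∀ n, a n + ∑ k ∈ Finset.range n, b k ≤ a 0 + ∑ k ∈ Finset.range n, e k := by
    intro n
    induction n with
    | zero => simp
    | succ n ih =>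
      rw [Finset.sum_range_succ, Finset.sum_range_succ]
      linarith [h n]
  refine ⟨summable_of_sum_range_le hb (c := a 0 + ∑' k, e k) fun n => ?_, ?_⟩
  · linarith [hsum n, ha n, he.sum_le_tsum (Finset.range n) fun k _ => he0 k]
  -- Subtracting the accumulated errors makes the sequence antitone; their finite total bounds it
  -- below.
  · set u : ℕ → ℝ := fun n => a n - ∑ k ∈ Finset.range n, e k with hu
    have hanti : Antitone u := by
      refine antitone_nat_of_succ_le fun n => ?_
      simp only [hu, Finset.sum_range_succ]
      linarith [h n, hb n]
    have hbdd : BddBelow (Set.range u) := by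
      refine ⟨-∑' k, e k, ?_⟩
      rintro _ ⟨n, rfl⟩
      simp only [hu]
      linarith [ha n, he.sum_le_tsum (Finset.range n) fun k _ => he0 k]
    refine ⟨_, ((tendsto_atTop_ciInf hanti hbdd).add he.hasSum.tendsto_sum_nat).congr fun n => ?_⟩
    simp [hu]

variable {E : Type*} [NormedAddCommGroup E] [InnerProductSpace ℝ E] {F : E → ℝ} {G : E → E}

/-- Perturbed gradient steps with absolutely summable errors: bounded iterates have square summable
gradients and converge to a minimizer. -/
theorem DescentInequality.summable_and_tendsto [ProperSpace E] (h : DescentInequality F G)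
    (hF : ConvexOn ℝ Set.univ F) (hFc : Continuous F) {z₀ : E} (hz₀ : ∀ y, F z₀ ≤ F y)
    {x e : ℕ → E} (hx : ∀ k, x (k + 1) = x k - G (x k) + e k) (he : Summable fun k => ‖e k‖)
    {M : ℝ} (hM : ∀ k, ‖x k‖ ≤ M) :
    Summable (fun k => ‖G (x k)‖ ^ 2) ∧ ∃ z, (∀ y, F z ≤ F y) ∧ Tendsto x atTop (𝓝 z) := by
  have main : ∀ z, (∀ y, F z ≤ F y) → Summable (fun k => ‖G (x k)‖ ^ 2) ∧
      ∃ l, Tendsto (fun k => ‖x k - z‖ ^ 2) atTop (𝓝 l) := by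
    intro z hz
    set D := M + ‖z‖ with hD
    have hxz : ∀ k, ‖x k - z‖ ≤ D := fun k => (norm_sub_le _ _).trans (by rw [hD]; linarith [hM k])
    have hD0 : 0 ≤ D := (norm_nonneg _).trans (hxz 0)
    have hGx : ∀ k, ‖x k - G (x k) - z‖ ≤ D := fun k => by
      have h1 := h.sq_norm_step_sub_le hF (x k) hz
      refine (abs_le_of_sq_le_sq' (a := ‖x k - G (x k) - z‖) (b := ‖x k - z‖) ?_
        (norm_nonneg _)).2.trans (hxz k)
      nlinarith [sq_nonneg ‖G (x k)‖]
    have he2 : ∀ k, ‖e k‖ ≤ 2 * D := fun k => by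
      have : e k = (x (k + 1) - z) - (x k - G (x k) - z) := by rw [hx k]; abel
      rw [this]
      exact (norm_sub_le _ _).trans (by linarith [hxz (k + 1), hGx k])
    -- In the expanded square the cross term is at most `2 * D * ‖e k‖`, and so is `‖e k‖ ^ 2` since
    -- `‖e k‖ ≤ 2 * D`; hence the factor 4.
    refine summable_and_tendsto_of_le_sub_add (e := fun k => 4 * D * ‖e k‖) (fun k => by positivity)
      (fun k => by positivity) (he.mul_left _) (fun k => by positivity) fun k => ?_
    have h1 := h.sq_norm_step_sub_le hF (x k) hz
    have h2 : x (k + 1) - z = (x k - G (x k) - z) + e k := by rw [hx k]; abel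
    have h3 := norm_add_le (x k - G (x k) - z) (e k)
    rw [← h2] at h3
    have h4 : ‖x (k + 1) - z‖ ^ 2 ≤ (‖x k - G (x k) - z‖ + ‖e k‖) ^ 2 := by gcongr
    nlinarith [mul_le_mul_of_nonneg_right (hGx k) (norm_nonneg (e k)),
      mul_le_mul_of_nonneg_right (he2 k) (norm_nonneg (e k))]
  have hsum := (main z₀ hz₀).1
  refine ⟨hsum, ?_⟩
  -- Opial's argument: a cluster point is a minimizer by passing to the limit in the tangent
  -- inequality, and the convergent distance to it tends to zero along a subsequence.
  obtain ⟨z, -, φ, hφ, hlim⟩ := (isCompact_closedBall (0 : E) M).tendsto_subseq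
    (x := x) fun k => by simpa using hM k
  have hG0 : Tendsto (fun k => G (x (φ k))) atTop (𝓝 0) := by
    rw [tendsto_zero_iff_norm_tendsto_zero]
    have := (hsum.tendsto_atTop_zero.comp hφ.tendsto_atTop).sqrt
    simpa [Function.comp_def, Real.sqrt_sq] using this
  have hz : ∀ y, F z ≤ F y := fun y => by
    have h1 : Tendsto (fun k => F (x (φ k)) + ⟪y - x (φ k), G (x (φ k))⟫) atTop
        (𝓝 (F z + ⟪y - z, (0 : E)⟫)) :=
      ((hFc.tendsto z).comp hlim).add ((tendsto_const_nhds.sub hlim).inner hG0)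
    rw [inner_zero_right, add_zero] at h1
    exact le_of_tendsto' h1 fun k => by linarith [h.inner_le_sub hF (x (φ k)) y]
  refine ⟨z, hz, ?_⟩
  obtain ⟨-, l, hl⟩ := main z hz
  have hl0 : l = 0 := by
    refine tendsto_nhds_unique (hl.comp hφ.tendsto_atTop) ?_
    have := ((hlim.sub_const z).norm.pow 2)
    simpa [Function.comp_def] using this
  rw [tendsto_iff_norm_sub_tendsto_zero]
  have := hl.sqrt
  simpa [hl0, Real.sqrt_sq] using this

end QuasiFejer

/-! ### The soft Moreau envelope: descent inequality, coercivity, moment bounds. -/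

section Envelope

variable {d : ℕ} {f : EuclideanSpace ℝ (Fin d) → ℝ} {lam δ : ℝ}

namespace StandingAssumption

lemma continuous_weight (hf : StandingAssumption f δ) :
    Continuous fun y => Real.exp (-f y / δ) := by
  have := hf.continuous
  fun_prop

lemma exists_weight_le (hf : StandingAssumption f δ) (hδ : 0 < δ) :
    ∃ C, 0 < C ∧ ∀ y, Real.exp (-f y / δ) ≤ C := by
  obtain ⟨z, hz⟩ := hf.exists_minimizer
  exact ⟨Real.exp (-f z / δ), Real.exp_pos _, fun y => by gcongr; exact hz y⟩

lemma integrable_weight (hf : StandingAssumption f δ) (hδ : 0 < δ)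
    (μ : Measure (EuclideanSpace ℝ (Fin d))) [IsFiniteMeasure μ] :
    Integrable (fun y => Real.exp (-f y / δ)) μ := by
  obtain ⟨C, -, hC⟩ := hf.exists_weight_le hδ
  refine Integrable.of_bound hf.continuous_weight.aestronglyMeasurable C (ae_of_all _ fun y => ?_)
  rw [Real.norm_eq_abs, Real.abs_exp]
  exact hC y

lemma integrable_weight_smul (hf : StandingAssumption f δ) (hδ : 0 < δ)
    (x : EuclideanSpace ℝ (Fin d)) :
    Integrable (fun y => Real.exp (-f y / δ) • y) (gaussian lam δ x) := by
  obtain ⟨C, -, hC⟩ := hf.exists_weight_le hδ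
  have hid : Integrable (fun y => y) (gaussian lam δ x) := IsGaussian.integrable_id
  refine (hid.norm.const_mul C).mono'
    (hf.continuous_weight.smul continuous_id).aestronglyMeasurable (ae_of_all _ fun y => ?_)
  rw [norm_smul, Real.norm_eq_abs, Real.abs_exp]
  gcongr
  exact hC y

lemma integral_weight_pos (hf : StandingAssumption f δ) (hδ : 0 < δ)
    (x : EuclideanSpace ℝ (Fin d)) : 0 < ∫ y, Real.exp (-f y / δ) ∂(gaussian lam δ x) :=
  integral_exp_pos (hf.integrable_weight hδ _)

lemma integral_weight_smul (hf : StandingAssumption f δ) (hδ : 0 < δ)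
    (x : EuclideanSpace ℝ (Fin d)) : ∫ y, Real.exp (-f y / δ) • y ∂(gaussian lam δ x) =
      (∫ y, Real.exp (-f y / δ) ∂(gaussian lam δ x)) • zprox f lam δ x := by
  rw [zprox, smul_smul, mul_inv_cancel₀ (hf.integral_weight_pos hδ x).ne', one_smul]

lemma integral_weight_smul_sub_zprox (hf : StandingAssumption f δ) (hδ : 0 < δ)
    (x : EuclideanSpace ℝ (Fin d)) :
    ∫ y, Real.exp (-f y / δ) • (y - zprox f lam δ x) ∂(gaussian lam δ x) = 0 := by
  simp_rw [smul_sub]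
  rw [integral_sub (hf.integrable_weight_smul hδ x) ((hf.integrable_weight hδ _).smul_const _),
    integral_smul_const, hf.integral_weight_smul hδ, sub_self]

lemma integrable_weight_smul_sub_zprox (hf : StandingAssumption f δ) (hδ : 0 < δ)
    (x : EuclideanSpace ℝ (Fin d)) :
    Integrable (fun y => Real.exp (-f y / δ) • (y - zprox f lam δ x)) (gaussian lam δ x) := by
  simp_rw [smul_sub]
  exact (hf.integrable_weight_smul hδ x).sub ((hf.integrable_weight hδ _).smul_const _)

/-- Jensen's inequality for the weighted Gaussian: bound the tilt below by its tangent at `zprox x`.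
The linear term integrates to zero because `zprox x` is the weighted mean. -/
lemma exp_mul_integral_weight_le (hf : StandingAssumption f δ) (hlam : 0 < lam) (hδ : 0 < δ)
    (x x' : EuclideanSpace ℝ (Fin d)) :
    Real.exp ((lam * δ)⁻¹ * ⟪x' - x, zprox f lam δ x⟫ -
        (2 * (lam * δ))⁻¹ * (‖x'‖ ^ 2 - ‖x‖ ^ 2)) *
      ∫ y, Real.exp (-f y / δ) ∂(gaussian lam δ x) ≤
        ∫ y, Real.exp (-f y / δ) ∂(gaussian lam δ x') := by
  rw [integral_gaussian_shift hlam hδ x x' fun y => Real.exp (-f y / δ)]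
  set a := (lam * δ)⁻¹ with ha
  set b := (2 * (lam * δ))⁻¹ * (‖x'‖ ^ 2 - ‖x‖ ^ 2) with hb
  set m := a * ⟪x' - x, zprox f lam δ x⟫ - b with hm
  have hint : Integrable (fun y => ⟪x' - x, Real.exp (-f y / δ) • (y - zprox f lam δ x)⟫)
      (gaussian lam δ x) := (hf.integrable_weight_smul_sub_zprox hδ x).const_inner _
  have hzero : ∫ y, ⟪x' - x, Real.exp (-f y / δ) • (y - zprox f lam δ x)⟫ ∂(gaussian lam δ x)
      = 0 := by
    rw [integral_inner (hf.integrable_weight_smul_sub_zprox hδ x),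
      hf.integral_weight_smul_sub_zprox hδ, inner_zero_right]
  have hlow : Real.exp m * ∫ y, Real.exp (-f y / δ) ∂(gaussian lam δ x) =
      ∫ y, (Real.exp m * Real.exp (-f y / δ) + Real.exp m * a *
        ⟪x' - x, Real.exp (-f y / δ) • (y - zprox f lam δ x)⟫) ∂(gaussian lam δ x) := by
    rw [integral_add ((hf.integrable_weight hδ _).const_mul _) (hint.const_mul _),
      integral_const_mul, integral_const_mul, hzero, mul_zero, add_zero]
  rw [hlow]
  refine integral_mono (((hf.integrable_weight hδ _).const_mul _).add (hint.const_mul _))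
    (integrable_gaussian_shift hlam hδ x x' (hf.integrable_weight hδ _)) fun y => ?_
  have h1 : a * ⟪x' - x, y⟫ - b = m + a * ⟪x' - x, y - zprox f lam δ x⟫ := by
    rw [inner_sub_right, hm]; ring
  simp only
  rw [h1, Real.exp_add, real_inner_smul_right]
  have h2 := Real.add_one_le_exp (a * ⟪x' - x, y - zprox f lam δ x⟫)
  have h3 := mul_le_mul_of_nonneg_left h2
    (mul_pos (Real.exp_pos m) (Real.exp_pos (-f y / δ))).le
  linarith

lemma descentInequality (hf : StandingAssumption f δ) (hlam : 0 < lam) (hδ : 0 < δ) :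
    DescentInequality (fun x => lam * softMoreau f lam δ x) (fun x => x - zprox f lam δ x) := by
  intro x x'
  have h1 := Real.log_le_log (mul_pos (Real.exp_pos _) (hf.integral_weight_pos hδ x))
    (hf.exp_mul_integral_weight_le hlam hδ x x')
  rw [Real.log_mul (Real.exp_pos _).ne' (hf.integral_weight_pos hδ x).ne', Real.log_exp] at h1
  have h2 := mul_le_mul_of_nonneg_left h1 (mul_pos hlam hδ).le
  have h3 : lam * δ * ((lam * δ)⁻¹ * ⟪x' - x, zprox f lam δ x⟫ -
      (2 * (lam * δ))⁻¹ * (‖x'‖ ^ 2 - ‖x‖ ^ 2)) =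
      ⟪x' - x, zprox f lam δ x⟫ - (‖x'‖ ^ 2 - ‖x‖ ^ 2) / 2 := by
    field_simp
  have h4 : ‖x'‖ ^ 2 - ‖x‖ ^ 2 = 2 * ⟪x' - x, x⟫ + ‖x' - x‖ ^ 2 := by
    rw [norm_sub_sq_real, inner_sub_left, real_inner_self_eq_norm_sq]; ring
  rw [mul_add, h3, h4] at h2
  simp only [softMoreau, inner_sub_right]
  linarith

/-- The Gaussian density tends to zero pointwise as its centre escapes and is uniformly bounded, so
Lebesgue integrability of the weight supplies the dominating function. -/
lemma tendsto_integral_weight_cocompact (hf : StandingAssumption f δ) (hlam : 0 < lam)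
    (hδ : 0 < δ) :
    Tendsto (fun x => ∫ y, Real.exp (-f y / δ) ∂(gaussian lam δ x))
      (cocompact (EuclideanSpace ℝ (Fin d))) (𝓝 0) := by
  have hs : 0 < lam * δ := mul_pos hlam hδ
  simp_rw [integral_gaussian hlam hδ]
  -- Written as a comap of `atTop` under the norm, the filter is visibly countably generated, as
  -- dominated convergence requires.
  rw [← integral_zero (EuclideanSpace ℝ (Fin d)) ℝ (μ := volume), ← Metric.cobounded_eq_cocompact,
    ← comap_norm_atTop]
  refine tendsto_integral_filter_of_dominated_convergence
    (fun y => (∫ v : EuclideanSpace ℝ (Fin d), Real.exp (-(2 * (lam * δ))⁻¹ * ‖v‖ ^ 2))⁻¹ *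
      Real.exp (-f y / δ)) (Eventually.of_forall fun x => ?_) (Eventually.of_forall fun x =>
      ae_of_all _ fun y => ?_) (hf.integrable.const_mul _) (ae_of_all _ fun y => ?_)
  · exact ((continuous_isotropicDensity x).smul hf.continuous_weight).aestronglyMeasurable
  · rw [norm_smul, Real.norm_of_nonneg (isotropicDensity_pos hs _ _).le, Real.norm_eq_abs,
      Real.abs_exp]
    gcongr
    exact isotropicDensity_le hs x y
  · rw [comap_norm_atTop, ← zero_smul ℝ (Real.exp (-f y / δ))]
    refine Tendsto.smul_const ?_ _
    unfold isotropicDensity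
    rw [← mul_zero (∫ v : EuclideanSpace ℝ (Fin d), Real.exp (-(2 * (lam * δ))⁻¹ * ‖v‖ ^ 2))⁻¹]
    refine Tendsto.const_mul _ (Real.tendsto_exp_atBot.comp ?_)
    have hnorm : Tendsto (fun x : EuclideanSpace ℝ (Fin d) => ‖y - x‖)
        (Bornology.cobounded _) atTop := by
      refine tendsto_atTop_mono (f := fun x => ‖x‖ - ‖y‖) (fun x => ?_)
        (tendsto_atTop_add_const_right _ (-‖y‖) tendsto_norm_cobounded_atTop)
      rw [norm_sub_rev]
      exact norm_sub_norm_le x y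
    exact ((tendsto_pow_atTop two_ne_zero).comp hnorm).const_mul_atTop_of_neg
      (by rw [neg_lt_zero]; positivity)

lemma tendsto_softMoreau_cocompact (hf : StandingAssumption f δ) (hlam : 0 < lam) (hδ : 0 < δ) :
    Tendsto (softMoreau f lam δ) (cocompact (EuclideanSpace ℝ (Fin d))) atTop := by
  have h1 : Tendsto (fun x => ∫ y, Real.exp (-f y / δ) ∂(gaussian lam δ x))
      (cocompact (EuclideanSpace ℝ (Fin d))) (𝓝[>] 0) :=
    tendsto_nhdsWithin_iff.2 ⟨hf.tendsto_integral_weight_cocompact hlam hδ,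
      Eventually.of_forall fun x => hf.integral_weight_pos hδ x⟩
  exact (Real.tendsto_log_nhdsGT_zero.comp h1).const_mul_atBot_of_neg (neg_lt_zero.2 hδ)

end StandingAssumption

lemma continuous_softMoreau (hconv : ConvexOn ℝ Set.univ (softMoreau f lam δ)) :
    Continuous (softMoreau f lam δ) :=
  continuousOn_univ.1 (hconv.continuousOn isOpen_univ)

lemma isClosed_argmin {g : EuclideanSpace ℝ (Fin d) → ℝ} (hg : Continuous g) :
    IsClosed (argmin g) := by
  simp only [argmin, Set.ofPred_forall]
  exact isClosed_iInter fun y => isClosed_le hg continuous_const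

namespace StandingAssumption

lemma nonempty_argmin_softMoreau (hf : StandingAssumption f δ) (hlam : 0 < lam) (hδ : 0 < δ)
    (hconv : ConvexOn ℝ Set.univ (softMoreau f lam δ)) :
    (argmin (softMoreau f lam δ)).Nonempty :=
  (continuous_softMoreau hconv).exists_forall_le (hf.tendsto_softMoreau_cocompact hlam hδ)

lemma continuous_zprox (hf : StandingAssumption f δ) (hlam : 0 < lam) (hδ : 0 < δ)
    (hconv : ConvexOn ℝ Set.univ (softMoreau f lam δ)) : Continuous (zprox f lam δ) := by
  have h := ((hf.descentInequality hlam hδ).lipschitzWith (hconv.smul hlam.le)).continuous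
  exact (continuous_id.sub h).congr fun x => sub_sub_cancel _ _

lemma norm_sub_zprox_le (hf : StandingAssumption f δ) (hlam : 0 < lam) (hδ : 0 < δ)
    (hconv : ConvexOn ℝ Set.univ (softMoreau f lam δ)) {z : EuclideanSpace ℝ (Fin d)}
    (hz : z ∈ argmin (softMoreau f lam δ)) (x : EuclideanSpace ℝ (Fin d)) :
    ‖x - zprox f lam δ x‖ ≤ ‖x - z‖ := by
  have h := hf.descentInequality hlam hδ
  have h1 := h.norm_map_sub_le (hconv.smul hlam.le) x z
  have h2 := h.eq_zero_of_forall_le (z := z) fun y => mul_le_mul_of_nonneg_left (hz y) hlam.le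
  simpa only [h2, sub_zero] using h1

/-- After centring the Gaussian at zero, the only dependence on `x` is through `x - zprox x`, whose
norm is at most `‖x - z‖ ≤ M + ‖z‖`. -/
lemma exists_integral_sq_norm_le (hf : StandingAssumption f δ) (hlam : 0 < lam) (hδ : 0 < δ)
    (hconv : ConvexOn ℝ Set.univ (softMoreau f lam δ)) (M : ℝ) :
    ∃ K, ∀ x, ‖x‖ ≤ M →
      ∫ y, ‖Real.exp (-f y / δ) • (y - zprox f lam δ x)‖ ^ 2 ∂(gaussian lam δ x) ≤ K := by
  obtain ⟨C, hC0, hC⟩ := hf.exists_weight_le hδ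
  obtain ⟨z, hz⟩ := hf.nonempty_argmin_softMoreau hlam hδ hconv
  refine ⟨∫ v : EuclideanSpace ℝ (Fin d), C ^ 2 * (‖v‖ + (M + ‖z‖)) ^ 2 ∂(gaussian lam δ 0), fun x hx => ?_⟩
  have hM : 0 ≤ M := (norm_nonneg x).trans hx
  have hcont : Continuous fun y => ‖Real.exp (-f y / δ) • (y - zprox f lam δ x)‖ ^ 2 := by
    have := hf.continuous_weight
    fun_prop
  rw [gaussian_eq_map_add x, integral_map (by fun_prop) hcont.aestronglyMeasurable]
  refine integral_mono_of_nonneg (ae_of_all _ fun v => by positivity) ?_ (ae_of_all _ fun v => ?_)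
  · have hL : MemLp (fun v : EuclideanSpace ℝ (Fin d) => v) 2 (gaussian lam δ 0) :=
      IsGaussian.memLp_two_id
    exact ((hL.norm.add (memLp_const (M + ‖z‖))).integrable_sq).const_mul _
  · simp only
    rw [norm_smul, mul_pow, Real.norm_eq_abs, Real.abs_exp]
    have h1 : ‖x + v - zprox f lam δ x‖ ≤ ‖v‖ + (M + ‖z‖) := by
      have h2 := hf.norm_sub_zprox_le hlam hδ hconv hz x
      rw [add_sub_right_comm]
      linarith [norm_add_le (x - zprox f lam δ x) v, norm_sub_le x z]
    gcongr
    exact hC _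

lemma memLp_weight_smul_sub_zprox (hf : StandingAssumption f δ) (hδ : 0 < δ)
    (x : EuclideanSpace ℝ (Fin d)) :
    MemLp (fun y => Real.exp (-f y / δ) • (y - zprox f lam δ x)) 2 (gaussian lam δ x) := by
  obtain ⟨C, hC0, hC⟩ := hf.exists_weight_le hδ
  have hL : MemLp (fun v : EuclideanSpace ℝ (Fin d) => v) 2 (gaussian lam δ x) :=
    IsGaussian.memLp_two_id
  have hcont : Continuous fun y => Real.exp (-f y / δ) • (y - zprox f lam δ x) := by
    have := hf.continuous_weight
    fun_prop
  refine (hL.sub (memLp_const (zprox f lam δ x))).of_le_mul (c := C) hcont.aestronglyMeasurable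
    (ae_of_all _ fun y => ?_)
  rw [norm_smul, Real.norm_eq_abs, Real.abs_exp]
  gcongr
  exacts [hC y, le_rfl]

end StandingAssumption

end Envelope

/-! ### Expected size of a centred sample mean. -/

section MonteCarlo

variable {d : ℕ} {α : Type*} [MeasurableSpace α] {ν : Measure α} [IsProbabilityMeasure ν]
  {φ : α → EuclideanSpace ℝ (Fin d)}

lemma memLp_sum_pi (n : ℕ) (hφ : MemLp φ 2 ν) :
    MemLp (fun y : Fin n → α => ∑ i, φ (y i)) 2 (Measure.pi fun _ => ν) :=
  memLp_finsetSum _ fun i _ => hφ.comp_measurePreserving (measurePreserving_eval _ i)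

/-- Coordinatewise, variances of independent terms add, and centring identifies variance with second
moment. -/
lemma integral_sq_norm_sum_pi (n : ℕ) (hφ : MemLp φ 2 ν) (hmean : ∫ y, φ y ∂ν = 0) :
    ∫ y, ‖∑ i : Fin n, φ (y i)‖ ^ 2 ∂(Measure.pi fun _ => ν) = n * ∫ y, ‖φ y‖ ^ 2 ∂ν := by
  have hcoord : ∀ l, MemLp (fun y => φ y l) 2 ν := fun l =>
    (EuclideanSpace.proj (𝕜 := ℝ) l).comp_memLp' hφ
  have hcoord_mean : ∀ l, ∫ y, φ y l ∂ν = 0 := fun l => by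
    have h := (EuclideanSpace.proj l : EuclideanSpace ℝ (Fin d) →L[ℝ] ℝ).integral_comp_comm
      (hφ.integrable one_le_two)
    rw [hmean, map_zero] at h
    exact h
  have hsum : ∀ l, MemLp (∑ i, fun y : Fin n → α => φ (y i) l) 2 (Measure.pi fun _ => ν) :=
    fun l => memLp_finsetSum' _ fun i _ =>
      (hcoord l).comp_measurePreserving (measurePreserving_eval _ i)
  have hvar : ∀ l, ∫ y, (∑ i : Fin n, φ (y i) l) ^ 2 ∂(Measure.pi fun _ => ν) =
      n * ∫ y, (φ y l) ^ 2 ∂ν := by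
    intro l
    have h := variance_sum_pi (ι := Fin n) (μ := fun _ => ν) (X := fun _ y => φ y l)
      fun _ => hcoord l
    rw [variance_of_integral_eq_zero (hsum l).aemeasurable, variance_of_integral_eq_zero
      (hcoord l).aemeasurable (hcoord_mean l)] at h
    · simpa using h
    · simp only [Finset.sum_apply]
      rw [integral_finsetSum]
      · refine Finset.sum_eq_zero fun i _ => ?_
        rw [← hcoord_mean l]
        exact integral_comp_eval (μ := fun _ : Fin n => ν) (i := i) (f := fun y => φ y l)
          (hcoord l).aestronglyMeasurable
      · exact fun i _ => ((hcoord l).comp_measurePreserving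
          (measurePreserving_eval (fun _ : Fin n => ν) i)).integrable one_le_two
  simp_rw [EuclideanSpace.real_norm_sq_eq]
  rw [integral_finsetSum _ fun l _ => (hcoord l).integrable_sq, integral_finsetSum, Finset.mul_sum]
  · refine Finset.sum_congr rfl fun l _ => ?_
    rw [← hvar l]
    simp
  · intro l _
    simpa using (hsum l).integrable_sq

lemma lintegral_enorm_average_le {n : ℕ} (hn : 0 < n) (hφ : MemLp φ 2 ν)
    (hmean : ∫ y, φ y ∂ν = 0) :
    ∫⁻ y, ‖(1 / (n : ℝ)) • ∑ i : Fin n, φ (y i)‖ₑ ∂(Measure.pi fun _ => ν) ≤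
      ENNReal.ofReal ((n : ℝ) ^ (-(1 / 2 : ℝ)) * (1 + ∫ y, ‖φ y‖ ^ 2 ∂ν)) := by
  have hn0 : (0 : ℝ) < n := by exact_mod_cast hn
  set r : ℝ := (n : ℝ) ^ (-(1 / 2 : ℝ)) with hr
  have hr0 : 0 < r := Real.rpow_pos_of_pos hn0 _
  have hr2 : r * r = 1 / n := by
    rw [hr, ← Real.rpow_add hn0]
    norm_num [Real.rpow_neg_one]
  have hint : Integrable (fun y : Fin n → α => r * (1 + (1 / (n : ℝ)) * ‖∑ i, φ (y i)‖ ^ 2))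
      (Measure.pi fun _ => ν) :=
    ((integrable_const 1).add ((memLp_sum_pi n hφ).integrable_norm_pow'.const_mul _)).const_mul _
  have hval : ∫ y : Fin n → α, r * (1 + (1 / (n : ℝ)) * ‖∑ i, φ (y i)‖ ^ 2)
      ∂(Measure.pi fun _ => ν) = r * (1 + ∫ y, ‖φ y‖ ^ 2 ∂ν) := by
    rw [integral_const_mul, integral_add (integrable_const 1)
      ((memLp_sum_pi n hφ).integrable_norm_pow'.const_mul _), integral_const_mul,
      integral_sq_norm_sum_pi n hφ hmean]
    simp [hn0.ne']
  rw [← hval, ofReal_integral_eq_lintegral_ofReal hint (ae_of_all _ fun y => by positivity)]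
  -- With `u = r * ‖∑ i, φ (y i)‖` the pointwise bound is `r * u ≤ r * (1 + u ^ 2)`, which replaces
  -- Cauchy–Schwarz and explains the constant 1.
  refine lintegral_mono fun y => ?_
  rw [← ofReal_norm]
  refine ENNReal.ofReal_le_ofReal ?_
  rw [norm_smul, Real.norm_of_nonneg (by positivity), ← hr2]
  nlinarith [sq_nonneg (r * ‖∑ i, φ (y i)‖ - 1), norm_nonneg (∑ i, φ (y i)),
    mul_nonneg hr0.le (sq_nonneg (r * ‖∑ i, φ (y i)‖ - 1))]

end MonteCarlo

/-! ### From conditional box probabilities to a joint law. -/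

section JointLaw

variable {Ω X ι : Type*} {Y : ι → Type*} [MeasurableSpace X] [Finite ι]
  [∀ i, MeasurableSpace (Y i)] {m m₀ : MeasurableSpace Ω}
  {P : Measure Ω} [IsProbabilityMeasure P]

/-- The joint law of `U` and `V` is determined by the conditional probabilities of boxes given a
σ-algebra for which `U` is measurable. -/
lemma map_prodMk_eq_compProd_of_condExp_box (hm : m ≤ m₀) {U : Ω → X} (hU : Measurable[m] U)
    {V : Ω → ∀ i, Y i} (hV : Measurable[m₀] V) {κ : Kernel X (∀ i, Y i)} [IsMarkovKernel κ]
    (h : ∀ B : ∀ i, Set (Y i), (∀ i, MeasurableSet (B i)) →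
      P⟦V ⁻¹' Set.univ.pi B | m⟧ =ᵐ[P] fun ω => (κ (U ω)).real (Set.univ.pi B)) :
    P.map (fun ω => (U ω, V ω)) = (P.map U) ⊗ₘ κ := by
  have hU₀ : Measurable[m₀] U := hU.mono hm le_rfl
  have hPU : IsProbabilityMeasure (P.map U) := Measure.isProbabilityMeasure_map hU₀.aemeasurable
  have hPUV : IsProbabilityMeasure (P.map fun ω => (U ω, V ω)) :=
    Measure.isProbabilityMeasure_map (hU₀.prodMk hV).aemeasurable
  refine Measure.ext_prod fun {s t} hs ht => ?_
  -- For fixed `s`, integrating the conditional probability over `U ⁻¹' s` identifies two finite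
  -- measures on boxes; boxes form a generating π-system.
  have hbox : ∀ B : ∀ i, Set (Y i), (∀ i, MeasurableSet (B i)) →
      (P.restrict (U ⁻¹' s)).map V (Set.univ.pi B) =
        ((P.map U).restrict s).bind κ (Set.univ.pi B) := by
    intro B hB
    have hB' : MeasurableSet (Set.univ.pi B) := MeasurableSet.univ_pi hB
    rw [Measure.map_apply hV hB', Measure.restrict_apply (hV hB'),
      Measure.bind_apply hB' κ.aemeasurable,
      setLIntegral_map hs (κ.measurable_coe hB') hU₀]
    have h1 := setIntegral_condExp hm (μ := P) (s := U ⁻¹' s)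
      (f := (V ⁻¹' Set.univ.pi B).indicator fun _ => (1 : ℝ))
      ((integrable_const _).indicator (hV hB')) (hU hs)
    rw [setIntegral_congr_ae (g := fun ω => (κ (U ω)).real (Set.univ.pi B)) (hU₀ hs)
      ((h B hB).mono fun ω hω _ => hω), integral_indicator_const _ (hV hB'), smul_eq_mul,
      mul_one, measureReal_restrict_apply (hV hB')] at h1
    rw [← ofReal_measureReal, ← h1, ofReal_integral_eq_lintegral_ofReal]
    · exact lintegral_congr fun ω => ofReal_measureReal (measure_ne_top _ _)
    · exact Integrable.of_bound
        ((κ.measurable_coe hB').comp hU₀).ennreal_toReal.aestronglyMeasurable 1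
        (ae_of_all _ fun ω => by
          rw [Real.norm_of_nonneg measureReal_nonneg]; exact measureReal_le_one)
    · exact ae_of_all _ fun ω => measureReal_nonneg
  have hfin : IsFiniteMeasure ((P.restrict (U ⁻¹' s)).map V) := by infer_instance
  have heq : (P.restrict (U ⁻¹' s)).map V = ((P.map U).restrict s).bind κ := by
    refine ext_of_generate_finite _ generateFrom_pi.symm isPiSystem_pi ?_ ?_
    · rintro _ ⟨B, hB, rfl⟩
      exact hbox B fun i => hB i (Set.mem_univ i)
    · simpa only [Set.pi_univ] using hbox (fun _ => Set.univ) fun _ => MeasurableSet.univ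
  rw [Measure.compProd_apply_prod hs ht, Measure.map_apply (hU₀.prodMk hV) (hs.prod ht),
    ← Measure.bind_apply ht κ.aemeasurable, ← heq, Measure.map_apply hV ht,
    Measure.restrict_apply (hV ht), Set.inter_comm]
  rfl

end JointLaw

/-! ### The sampling kernel. -/

section Sampling

variable {d : ℕ} {lam δ : ℝ}

lemma measurable_gaussian :
    Measurable (gaussian lam δ : EuclideanSpace ℝ (Fin d) → Measure (EuclideanSpace ℝ (Fin d))) := by
  refine Measure.measurable_of_measurable_coe _ fun B hB => ?_
  have hadd : Measurable fun p : EuclideanSpace ℝ (Fin d) × EuclideanSpace ℝ (Fin d) =>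
      p.1 + p.2 := by fun_prop
  have hcoe : (fun x => gaussian lam δ x B) = fun x : EuclideanSpace ℝ (Fin d) =>
      gaussian lam δ 0 (Prod.mk x ⁻¹' ((fun p => p.1 + p.2) ⁻¹' B)) := by
    ext x
    rw [gaussian_eq_map_add x, Measure.map_apply (by fun_prop) hB]
    rfl
  rw [hcoe]
  exact measurable_measure_prodMk_left (hadd hB)

/-- The law of `n` independent samples from `N(x, λδ I)`, as a kernel in `x`. -/
def sampleKernel (lam δ : ℝ) (d n : ℕ) :
    Kernel (EuclideanSpace ℝ (Fin d)) (Fin n → EuclideanSpace ℝ (Fin d)) where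
  toFun x := Measure.pi fun _ => gaussian lam δ x
  measurable' := by
    refine Measurable.measure_of_isPiSystem_of_isProbabilityMeasure generateFrom_pi.symm
      isPiSystem_pi ?_
    rintro _ ⟨B, hB, rfl⟩
    simp_rw [Measure.pi_pi]
    exact Finset.measurable_prod _ fun i _ =>
      (Measure.measurable_coe (show MeasurableSet (B i) from hB i (Set.mem_univ i))).comp measurable_gaussian

lemma sampleKernel_apply (n : ℕ) (x : EuclideanSpace ℝ (Fin d)) :
    sampleKernel lam δ d n x = Measure.pi fun _ => gaussian lam δ x := rfl

instance (n : ℕ) : IsMarkovKernel (sampleKernel lam δ d n) :=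
  ⟨fun x => by rw [sampleKernel_apply]; infer_instance⟩

end Sampling

/-! ### The error of the Monte Carlo estimator. -/

section MonteCarloError

variable {d : ℕ} {f : EuclideanSpace ℝ (Fin d) → ℝ} {lam δ : ℝ}

/-- The numerator `(1/n) ∑ᵢ exp(-f(yᵢ)/δ) (yᵢ - t)` of the error of `zproxHat` as an estimator of
`t`. -/
def weightedDeviation {n : ℕ} (f : EuclideanSpace ℝ (Fin d) → ℝ) (δ : ℝ)
    (t : EuclideanSpace ℝ (Fin d)) (y : Fin n → EuclideanSpace ℝ (Fin d)) :
    EuclideanSpace ℝ (Fin d) :=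
  (1 / (n : ℝ)) • ∑ i, Real.exp (-f (y i) / δ) • (y i - t)

lemma zproxHat_sub_eq {n : ℕ} (hn : 0 < n) (t : EuclideanSpace ℝ (Fin d))
    (y : Fin n → EuclideanSpace ℝ (Fin d)) :
    zproxHat f δ y - t = (empiricalNormalization f δ y)⁻¹ • weightedDeviation f δ t y := by
  have hn0 : (n : ℝ) ≠ 0 := by exact_mod_cast hn.ne'
  have : Nonempty (Fin n) := ⟨⟨0, hn⟩⟩
  have hW : ∑ i, Real.exp (-f (y i) / δ) ≠ 0 :=
    (Finset.sum_pos (fun i _ => Real.exp_pos _) Finset.univ_nonempty).ne'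
  rw [zproxHat, empiricalNormalization, weightedDeviation, smul_smul, mul_inv, mul_right_comm,
    inv_mul_cancel₀ (one_div_ne_zero hn0), one_mul]
  simp_rw [smul_sub]
  rw [Finset.sum_sub_distrib, ← Finset.sum_smul, smul_sub, smul_smul, inv_mul_cancel₀ hW, one_smul]

lemma continuous_weightedDeviation {n : ℕ} (hf : Continuous f) :
    Continuous fun p : EuclideanSpace ℝ (Fin d) × (Fin n → EuclideanSpace ℝ (Fin d)) =>
      weightedDeviation f δ p.1 p.2 := by
  unfold weightedDeviation
  fun_prop

lemma measurable_zproxHat {n : ℕ} (hf : Continuous f) :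
    Measurable (zproxHat f δ : (Fin n → EuclideanSpace ℝ (Fin d)) → EuclideanSpace ℝ (Fin d)) := by
  have h1 : Measurable fun y : Fin n → EuclideanSpace ℝ (Fin d) =>
      ∑ i, Real.exp (-f (y i) / δ) := Continuous.measurable (by fun_prop)
  have h2 : Measurable fun y : Fin n → EuclideanSpace ℝ (Fin d) =>
      ∑ i, Real.exp (-f (y i) / δ) • y i := Continuous.measurable (by fun_prop)
  exact h1.inv.smul h2

lemma StandingAssumption.lintegral_weightedDeviation_le (hf : StandingAssumption f δ)
    (hδ : 0 < δ) {n : ℕ} (hn : 0 < n) (x : EuclideanSpace ℝ (Fin d)) :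
    ∫⁻ y, ‖weightedDeviation f δ (zprox f lam δ x) y‖ₑ ∂(sampleKernel lam δ d n x) ≤
      ENNReal.ofReal ((n : ℝ) ^ (-(1 / 2 : ℝ)) * (1 +
        ∫ y, ‖Real.exp (-f y / δ) • (y - zprox f lam δ x)‖ ^ 2 ∂(gaussian lam δ x))) :=
  lintegral_enorm_average_le (φ := fun y => Real.exp (-f y / δ) • (y - zprox f lam δ x)) hn
    (hf.memLp_weight_smul_sub_zprox hδ x)
    (hf.integral_weight_smul_sub_zprox hδ x)

end MonteCarloError

/-! ### Almost sure behaviour of the iterates. -/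

namespace IsSZoppa

variable {Ω : Type*} [mΩ : MeasurableSpace Ω] {P : Measure Ω}
  {d : ℕ} {f : EuclideanSpace ℝ (Fin d) → ℝ} {lam δ : ℝ} {N : ℕ → ℕ}
  {x₀ : EuclideanSpace ℝ (Fin d)} {y : (k : ℕ) → Fin (N k) → Ω → EuclideanSpace ℝ (Fin d)}
  {x : ℕ → Ω → EuclideanSpace ℝ (Fin d)}

lemma history_le (hx : IsSZoppa P f lam δ N x₀ y x) (k : ℕ) : history y k ≤ mΩ :=
  iSup_le fun j => iSup_le fun _ => iSup_le fun i => (hx.measurable_sample j i).comap_le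

lemma measurable_history (hx : IsSZoppa P f lam δ N x₀ y x) (hf : Continuous f) (k : ℕ) :
    Measurable[history y k] (x k) := by
  cases k with
  | zero =>
    rw [show x 0 = fun _ => x₀ from funext hx.initial]
    exact measurable_const
  | succ k =>
    rw [show x (k + 1) = fun ω => zproxHat f δ fun i => y k i ω from funext (hx.step k)]
    refine (measurable_zproxHat hf).comp
      (@measurable_pi_lambda _ _ _ (history y (k + 1)) _ _ fun i => ?_)
    have hle : MeasurableSpace.comap (y k i) inferInstance ≤ history y (k + 1) :=
      le_iSup_of_le k (le_iSup_of_le k.lt_succ_self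
        (le_iSup (fun i => MeasurableSpace.comap (y k i) inferInstance) i))
    exact (comap_measurable (y k i)).mono hle le_rfl

lemma measurable_iterate (hx : IsSZoppa P f lam δ N x₀ y x) (hf : Continuous f) (k : ℕ) :
    Measurable (x k) :=
  (hx.measurable_history hf k).mono (hx.history_le k) le_rfl

lemma map_iterate_sample [IsProbabilityMeasure P] (hx : IsSZoppa P f lam δ N x₀ y x)
    (hf : Continuous f) (k : ℕ) :
    P.map (fun ω => (x k ω, fun i => y k i ω)) =
      (P.map (x k)) ⊗ₘ sampleKernel lam δ d (N k) := by
  refine map_prodMk_eq_compProd_of_condExp_box (hx.history_le k) (hx.measurable_history hf k)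
    (measurable_pi_lambda _ fun i => hx.measurable_sample k i) fun B hB => ?_
  have hpre : (fun ω i => y k i ω) ⁻¹' Set.univ.pi B = ⋂ i, y k i ⁻¹' B i := by
    ext ω; simp
  rw [hpre]
  filter_upwards [hx.sampling k B hB] with ω hω
  rw [hω, sampleKernel_apply, measureReal_def, Measure.pi_pi, ENNReal.toReal_prod]
  rfl

/-- The truncation involves `x k` alone, so integrating out the fresh samples leaves it untouched;
boundedness of the whole trajectory would depend on these and later samples. -/
lemma lintegral_indicator_weightedDeviation_le [IsProbabilityMeasure P]
    (hx : IsSZoppa P f lam δ N x₀ y x) (hf : StandingAssumption f δ) (hlam : 0 < lam) (hδ : 0 < δ)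
    (hconv : ConvexOn ℝ Set.univ (softMoreau f lam δ)) {k : ℕ} (hN : 0 < N k) {M K : ℝ}
    (hK : ∀ x, ‖x‖ ≤ M →
      ∫ y, ‖Real.exp (-f y / δ) • (y - zprox f lam δ x)‖ ^ 2 ∂(gaussian lam δ x) ≤ K) :
    ∫⁻ ω, {ω | ‖x k ω‖ ≤ M}.indicator
      (fun ω => ‖weightedDeviation f δ (zprox f lam δ (x k ω)) (fun i => y k i ω)‖ₑ) ω ∂P ≤
        ENNReal.ofReal ((N k : ℝ) ^ (-(1 / 2 : ℝ)) * (1 + K)) := by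
  set S : Set (EuclideanSpace ℝ (Fin d) × (Fin (N k) → EuclideanSpace ℝ (Fin d))) :=
    {p | ‖p.1‖ ≤ M} with hS
  have hmem : ∀ a v, (a, v) ∈ S ↔ ‖a‖ ≤ M := fun a v => Iff.rfl
  have hSm : MeasurableSet S := measurableSet_le (by fun_prop) measurable_const
  set h : EuclideanSpace ℝ (Fin d) × (Fin (N k) → EuclideanSpace ℝ (Fin d)) → ℝ≥0∞ :=
    S.indicator fun p => ‖weightedDeviation f δ (zprox f lam δ p.1) p.2‖ₑ with hh
  have hhm : Measurable h := by
    refine Measurable.indicator (Continuous.measurable ?_) hSm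
    exact ((continuous_weightedDeviation hf.continuous).comp
      (((hf.continuous_zprox hlam hδ hconv).comp continuous_fst).prodMk continuous_snd)).enorm
  have hpair : Measurable fun ω => (x k ω, fun i => y k i ω) :=
    (hx.measurable_iterate hf.continuous k).prodMk
      (measurable_pi_lambda _ fun i => hx.measurable_sample k i)
  have hprob : IsProbabilityMeasure (P.map (x k)) :=
    Measure.isProbabilityMeasure_map (hx.measurable_iterate hf.continuous k).aemeasurable
  calc _ = ∫⁻ ω, h (x k ω, fun i => y k i ω) ∂P := rfl
    _ = ∫⁻ a, ∫⁻ v, h (a, v) ∂(sampleKernel lam δ d (N k) a) ∂(P.map (x k)) := by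
      rw [← lintegral_map hhm hpair, hx.map_iterate_sample hf.continuous,
        Measure.lintegral_compProd hhm]
    _ ≤ ∫⁻ _, ENNReal.ofReal ((N k : ℝ) ^ (-(1 / 2 : ℝ)) * (1 + K)) ∂(P.map (x k)) := by
      refine lintegral_mono fun a => ?_
      by_cases ha : ‖a‖ ≤ M
      · have : ∀ v, h (a, v) = ‖weightedDeviation f δ (zprox f lam δ a) v‖ₑ := fun v =>
          Set.indicator_of_mem ((hmem a v).2 ha) _
        simp_rw [this]
        refine (hf.lintegral_weightedDeviation_le hδ hN a).trans (ENNReal.ofReal_le_ofReal ?_)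
        gcongr
        exact hK a ha
      · have : ∀ v, h (a, v) = 0 := fun v => Set.indicator_of_notMem (mt (hmem a v).1 ha) _
        simp [this]
    _ = _ := by simp

lemma ae_summable_weightedDeviation [IsProbabilityMeasure P]
    (hx : IsSZoppa P f lam δ N x₀ y x) (hf : StandingAssumption f δ) (hlam : 0 < lam) (hδ : 0 < δ)
    (hconv : ConvexOn ℝ Set.univ (softMoreau f lam δ)) (hNpos : ∀ k, 0 < N k)
    (hN : Summable fun k => (N k : ℝ) ^ (-(1 / 2 : ℝ))) :
    ∀ᵐ ω ∂P, (∃ M : ℝ, ∀ k, ‖x k ω‖ ≤ M) →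
      Summable fun k => ‖weightedDeviation f δ (zprox f lam δ (x k ω)) (fun i => y k i ω)‖ := by
  have key : ∀ M : ℕ, ∀ᵐ ω ∂P, ∑' k, {ω | ‖x k ω‖ ≤ M}.indicator
      (fun ω => ‖weightedDeviation f δ (zprox f lam δ (x k ω)) (fun i => y k i ω)‖ₑ) ω < ∞ := by
    intro M
    obtain ⟨K, hK⟩ := hf.exists_integral_sq_norm_le hlam hδ hconv (M : ℝ)
    have hmeas : ∀ k, Measurable ({ω | ‖x k ω‖ ≤ M}.indicator
        (fun ω => ‖weightedDeviation f δ (zprox f lam δ (x k ω)) (fun i => y k i ω)‖ₑ)) := by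
      intro k
      have hxk := hx.measurable_iterate hf.continuous k
      refine Measurable.indicator ?_ (measurableSet_le hxk.norm measurable_const)
      exact ((continuous_weightedDeviation hf.continuous).measurable.comp
        (((hf.continuous_zprox hlam hδ hconv).measurable.comp hxk).prodMk
          (measurable_pi_lambda _ fun i => hx.measurable_sample k i))).enorm
    refine ae_lt_top (Measurable.tsum hmeas) ?_
    rw [lintegral_tsum fun k => (hmeas k).aemeasurable]
    refine ne_top_of_le_ne_top (hN.mul_right (1 + K)).tsum_ofReal_ne_top
      (ENNReal.tsum_le_tsum fun k => ?_)
    exact hx.lintegral_indicator_weightedDeviation_le hf hlam hδ hconv (hNpos k) hK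
  -- On a bounded trajectory an integer bound makes every indicator equal to one.
  filter_upwards [ae_all_iff.2 key] with ω hω ⟨M, hM⟩
  obtain ⟨n, hn⟩ := exists_nat_ge M
  have h := hω n
  have hmem : ∀ k, ω ∈ {ω | ‖x k ω‖ ≤ n} := fun k => (hM k).trans hn
  rw [tsum_congr fun k => Set.indicator_of_mem (hmem k) _] at h
  simpa using ENNReal.summable_toReal h.ne

lemma ae_summable_and_tendsto [IsProbabilityMeasure P]
    (hx : IsSZoppa P f lam δ N x₀ y x) (hf : StandingAssumption f δ) (hlam : 0 < lam) (hδ : 0 < δ)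
    (hconv : ConvexOn ℝ Set.univ (softMoreau f lam δ)) (hNpos : ∀ k, 0 < N k)
    (hN : Summable fun k => (N k : ℝ) ^ (-(1 / 2 : ℝ))) :
    ∀ᵐ ω ∂P, (∃ M : ℝ, ∀ k, ‖x k ω‖ ≤ M) →
      (∃ ε : ℝ, 0 < ε ∧ ∀ k, ε ≤ empiricalNormalization f δ (fun i => y k i ω)) →
      Summable (fun k => ‖zprox f lam δ (x k ω) - x k ω‖ ^ 2) ∧
        ∃ z ∈ argmin (softMoreau f lam δ), Tendsto (fun k => x k ω) atTop (𝓝 z) := by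
  filter_upwards [hx.ae_summable_weightedDeviation hf hlam hδ hconv hNpos hN]
    with ω hω hbdd ⟨ε, hε, hεk⟩
  have hsum := hω hbdd
  obtain ⟨M, hM⟩ := hbdd
  obtain ⟨z₀, hz₀⟩ := hf.nonempty_argmin_softMoreau hlam hδ hconv
  have herr : Summable fun k => ‖x (k + 1) ω - zprox f lam δ (x k ω)‖ := by
    refine Summable.of_nonneg_of_le (fun k => norm_nonneg _) (fun k => ?_) (hsum.mul_left ε⁻¹)
    rw [hx.step, zproxHat_sub_eq (hNpos k), norm_smul, norm_inv,
      Real.norm_of_nonneg (hε.le.trans (hεk k))]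
    gcongr
    exact hεk k
  -- Since `x - G x = zprox x`, the perturbation is `x (k + 1) - zprox (x k)`.
  obtain ⟨h1, z, hz, hlim⟩ := (hf.descentInequality hlam hδ).summable_and_tendsto
    (hconv.smul hlam.le) ((continuous_softMoreau hconv).const_mul lam) (z₀ := z₀)
    (fun y => mul_le_mul_of_nonneg_left (hz₀ y) hlam.le) (x := fun k => x k ω)
    (fun k => by rw [sub_sub_cancel, add_sub_cancel]) herr hM
  refine ⟨?_, z, fun y => le_of_mul_le_mul_left (hz y) hlam, hlim⟩
  simpa only [norm_sub_rev] using h1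

end IsSZoppa

/-- Freezing the sequence at `c₀` where it diverges gives an everywhere convergent sequence with
measurable limit; limits outside `S` are then replaced by `c₀`. -/
lemma exists_measurable_forall_mem_tendsto {Ω E : Type*} [MeasurableSpace Ω]
    [TopologicalSpace E] [PolishSpace E] [MeasurableSpace E] [BorelSpace E] {x : ℕ → Ω → E}
    (hx : ∀ k, Measurable (x k)) {S : Set E} (hS : IsClosed S) (hne : S.Nonempty) :
    ∃ z : Ω → E, Measurable z ∧ (∀ ω, z ω ∈ S) ∧
      ∀ ω, (∃ c ∈ S, Tendsto (fun k => x k ω) atTop (𝓝 c)) →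
        Tendsto (fun k => x k ω) atTop (𝓝 (z ω)) := by
  classical
  obtain ⟨c₀, hc₀⟩ := hne
  set A : Set Ω := {ω | ∃ c, Tendsto (fun k => x k ω) atTop (𝓝 c)} with hA
  have hAm : MeasurableSet A := measurableSet_exists_tendsto hx
  have hlim : ∀ ω, ∃ c, Tendsto (fun k => if ω ∈ A then x k ω else c₀) atTop (𝓝 c) := by
    intro ω
    by_cases hω : ω ∈ A
    · simp only [if_pos hω]
      exact hω
    · exact ⟨c₀, by simp only [hω, if_false, tendsto_const_nhds]⟩
  choose l hl using hlim
  have hlm : Measurable l := by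
    let := TopologicalSpace.upgradeIsCompletelyMetrizable E
    exact measurable_of_tendsto_metrizable (fun k => Measurable.ite hAm (hx k) measurable_const)
      (tendsto_pi_nhds.2 hl)
  refine ⟨fun ω => if l ω ∈ S then l ω else c₀,
    Measurable.ite (hlm hS.measurableSet) hlm measurable_const, fun ω => ?_, ?_⟩
  · dsimp only
    split_ifs with h
    exacts [h, hc₀]
  · rintro ω ⟨c, hc, hω⟩
    have hωA : ω ∈ A := ⟨c, hω⟩
    have h := hl ω
    simp only [hωA, if_true] at h
    have hlc : l ω = c := tendsto_nhds_unique h hω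
    simpa only [hlc, hc, if_true] using hω

end SZoppa

end

theorem theorem7 {Ω : Type*} [MeasurableSpace Ω] (P : Measure Ω) [IsProbabilityMeasure P]
    {d : ℕ} (f : EuclideanSpace ℝ (Fin d) → ℝ) (lam δ : ℝ) (hlam : 0 < lam) (hδ : 0 < δ)
    (hf : SZoppa.StandingAssumption f δ)
    (hconv : ConvexOn ℝ Set.univ (SZoppa.softMoreau f lam δ))
    (N : ℕ → ℕ) (hNpos : ∀ k, 0 < N k)
    (hN : Summable (fun k => (N k : ℝ) ^ (-(1 / 2 : ℝ))))
    (x₀ : EuclideanSpace ℝ (Fin d))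
    (y : (k : ℕ) → Fin (N k) → Ω → EuclideanSpace ℝ (Fin d))
    (x : ℕ → Ω → EuclideanSpace ℝ (Fin d))
    (hx : SZoppa.IsSZoppa P f lam δ N x₀ y x) :
    (∀ᵐ ω ∂P,
      (∃ M : ℝ, ∀ k, ‖x k ω‖ ≤ M) →
      (∃ ε : ℝ, 0 < ε ∧ ∀ k, ε ≤ SZoppa.empiricalNormalization f δ (fun i => y k i ω)) →
      Summable (fun k => ‖SZoppa.zprox f lam δ (x k ω) - x k ω‖ ^ 2)) ∧
    ∃ xbar : Ω → EuclideanSpace ℝ (Fin d), Measurable xbar ∧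
      (∀ ω, xbar ω ∈ SZoppa.argmin (SZoppa.softMoreau f lam δ)) ∧
      ∀ᵐ ω ∂P,
        (∃ M : ℝ, ∀ k, ‖x k ω‖ ≤ M) →
        (∃ ε : ℝ, 0 < ε ∧ ∀ k, ε ≤ SZoppa.empiricalNormalization f δ (fun i => y k i ω)) →
        Tendsto (fun k => x k ω) atTop (𝓝 (xbar ω)) := by
  have hmain := hx.ae_summable_and_tendsto hf hlam hδ hconv hNpos hN
  obtain ⟨xbar, hmeas, hmem, hlim⟩ := SZoppa.exists_measurable_forall_mem_tendsto
    (hx.measurable_iterate hf.continuous)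
    (SZoppa.isClosed_argmin (SZoppa.continuous_softMoreau hconv))
    (hf.nonempty_argmin_softMoreau hlam hδ hconv)
  refine ⟨?_, xbar, hmeas, hmem, ?_⟩
  · filter_upwards [hmain] with ω hω hbdd hε using (hω hbdd hε).1
  · filter_upwards [hmain] with ω hω hbdd hε using hlim ω (hω hbdd hε).2
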